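/- Let $\ell_1=\ell_1(\mathbb Z_+)$ be the complex Banach space of absolutely summable sequences, and let $X=\bigl(\bigoplus_{l\ge 1}\ell_1\bigr)_{c_0}$ be the $c_0$-sum of countably many copies of $\ell_1$, i.e. the complex Banach space of all sequences $x=(x(l))_{l\ge1}$ in $\ell_1$ with $\|x(l)\|_1\to0$, with norm $\|x\|=\sup_l\|x(l)\|_1$. For bounded linear operators $T_1,T_2$ on $X$, a vector $x\in X$ is called $d$-hypercyclic for the pair $(T_1,T_2)$ if $\{(T_1^nx,T_2^nx):n\ge0\}$ is dense in $X\times X$, and $d$-frequently hypercyclic for $(T_1,T_2)$ if for every non-empty open set $V\subset X\times X$ the set $A=\{n\ge 0:(T_1^nx,T_2^nx)\in V\}$ has positive lower density, i.e. $\liminf_{N\to\infty}\frac1N\#(A\cap\{0,\dots,N-1\})>0$. The pair is called $d$-frequently hypercyclic if it admits a $d$-frequently hypercyclic vector. **Theorem.** There exist bounded linear operators $T_1,T_2$ on $X$ such that the pair $(T_1,T_2)$ is $d$-frequently hypercyclic, but the set of $d$-hypercyclic vectors for $(T_1,T_2)$ is not dense in $X$. In particular, there exists a Banach space carrying such a pair.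 -/

import Mathlib

open Filter Topology
open scoped ZeroAtInfty

noncomputable section

/-- The lower asymptotic density of a set of natural numbers,
`liminf_{N → ∞} #(A ∩ {0, …, N - 1}) / N`. -/
def lowerDensity (A : Set ℕ) : ℝ :=
  liminf (fun N : ℕ => ((A ∩ Set.Iio N).ncard : ℝ) / (N : ℝ)) atTop

section Dynamics

variable {𝕜 X ι : Type*} [NontriviallyNormedField 𝕜] [AddCommGroup X] [Module 𝕜 X]
  [TopologicalSpace X]

/-- The set of all times `n` at which the orbit of `x` under `T` visits `V`. -/
def visitSet (T : X →L[𝕜] X) (x : X) (V : Set X) : Set ℕ :=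
  {n : ℕ | (T ^ n) x ∈ V}

/-- `x` is a hypercyclic vector for `T`: its orbit is dense. -/
def IsHypercyclicVector (T : X →L[𝕜] X) (x : X) : Prop :=
  Dense (Set.range fun n : ℕ => (T ^ n) x)

/-- `x` is a frequently hypercyclic vector for `T`: its orbit visits every non-empty open set
along a set of times of positive lower density. -/
def IsFrequentlyHypercyclicVector (T : X →L[𝕜] X) (x : X) : Prop :=
  ∀ V : Set X, IsOpen V → V.Nonempty → 0 < lowerDensity (visitSet T x V)

/-- The direct sum of a tuple of operators, acting coordinatewise on the power of the space
(with the product topology). -/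
def directSumOperator (T : ι → X →L[𝕜] X) : (ι → X) →L[𝕜] (ι → X) :=
  ContinuousLinearMap.pi fun i => (T i).comp (ContinuousLinearMap.proj i)

theorem directSumOperator_pow_apply (T : ι → X →L[𝕜] X) (n : ℕ) (x : ι → X) (i : ι) :
    (directSumOperator T ^ n) x i = (T i ^ n) (x i) := by
  induction n generalizing x with
  | zero => rfl
  | succ n ih =>
    rw [pow_succ, pow_succ]
    exact ih (directSumOperator T x)

/-- `x` is a `d`-hypercyclic vector for the tuple `T`: the diagonal vector `(x, …, x)` is
hypercyclic for the direct sum of the operators. -/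
def IsDHypercyclicVector (T : ι → X →L[𝕜] X) (x : X) : Prop :=
  IsHypercyclicVector (directSumOperator T) (fun _ => x)

theorem isDHypercyclicVector_iff (T : ι → X →L[𝕜] X) (x : X) :
    IsDHypercyclicVector T x ↔ Dense (Set.range fun n : ℕ => fun i : ι => (T i ^ n) x) := by
  have h : (fun n : ℕ => (directSumOperator T ^ n) (fun _ => x)) =
      fun n : ℕ => fun i : ι => (T i ^ n) x := by
    funext n i
    exact directSumOperator_pow_apply T n _ i
  unfold IsDHypercyclicVector IsHypercyclicVector
  rw [h]

/-- `x` is a `d`-frequently hypercyclic vector for the tuple `T`: the diagonal vector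
`(x, …, x)` is frequently hypercyclic for the direct sum of the operators. -/
def IsDFrequentlyHypercyclicVector (T : ι → X →L[𝕜] X) (x : X) : Prop :=
  IsFrequentlyHypercyclicVector (directSumOperator T) (fun _ => x)

/-- The set of `d`-hypercyclic vectors of the tuple `T`. -/
def dHC (T : ι → X →L[𝕜] X) : Set X := {x : X | IsDHypercyclicVector T x}

/-- The tuple `T` is `d`-frequently hypercyclic. -/
def DFrequentlyHypercyclic (T : ι → X →L[𝕜] X) : Prop :=
  ∃ x : X, IsDFrequentlyHypercyclicVector T x

/-- The tuple `T` is densely `d`-hypercyclic. -/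
def DenselyDHypercyclic (T : ι → X →L[𝕜] X) : Prop := Dense (dHC T)

end Dynamics

/-- The complex Banach space of absolutely summable sequences. -/
abbrev EllOne : Type := lp (fun _ : ℕ => ℂ) 1

/-- The `c₀`-sum of countably many copies of `ℓ₁`: sequences `(x(l))` of elements of `ℓ₁` with
`‖x(l)‖ → 0` (functions on the discrete space `ℕ` vanishing at infinity), with the norm
`sup_l ‖x(l)‖`. -/
abbrev CZeroSumEllOne : Type := C₀(ℕ, EllOne)

end

noncomputable section

/-! ### Domination of rows in `ℓ₁`. -/

section EllOneRows

/-! Write `B = backwardShift`, `L = liftRows`, `L' = liftPerturbed`. With `S = 1 + c L'` invertible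
for small `c ≠ 0`, take the pair `B`, `S⁻¹ B S`. Since `S⁻¹ Bⁿ S x = S⁻¹ (Bⁿ x + c Bⁿ L' x)`, the
joint orbit of `x` is a homeomorphic image of the sequence `(Bⁿ x, Bⁿ L' x)`, so everything reduces
to that sequence.

Obstruction: the weights of `B` telescope so that passing to column `depth n` costs `Bⁿ L x` only a
factor `depth n + 1` at coordinate `(0, 0)`, whereas `L'` adds there `x₀₀ (depth n + 4)`. If `|x₀₀|
≥ 1`, then `Bⁿ x` and `Bⁿ L' x` cannot both have norm below 1 (`one_le_norm_pow_liftPerturbed`), and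
this excludes an open set of `x`.

Existence: on `x₀₀ = 0` the perturbation vanishes. Targets `P q`, `Q q` with slowly growing supports
are written into well separated patches of rows, each label `q` recurring with positive density.
Then `x = placed P + buryRows (placed Q)` satisfies `L x = placed Q`, because the columns of `placed
P` are too shallow to survive `L`. Conversely the buried part is deep enough to be invisible in `Bⁿ
x` (`norm_pow_bury_placed_le`).

A depth of order `√k` serves both sides: it is large enough to hide the targets, yet `depth k / k →
0`, so that `fastVector` lies in the space. -/

theorem sum_norm_le_of_dominated {f : ℕ → ℂ} (u : EllOne) {C : ℝ} (hC : 0 ≤ C) (σ : ℕ → ℕ)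
    (hσ : Set.InjOn σ {l | f l ≠ 0}) (h : ∀ l, f l ≠ 0 → ‖f l‖ ≤ C * ‖u (σ l)‖) (s : Finset ℕ) :
    ∑ l ∈ s, ‖f l‖ ≤ C * ‖u‖ := by
  classical
  have hu : ∀ s : Finset ℕ, ∑ l ∈ s, ‖u l‖ ≤ ‖u‖ := by
    intro s
    simpa using lp.sum_rpow_le_norm_rpow (p := 1) (by simp) u s
  calc ∑ l ∈ s, ‖f l‖ = ∑ l ∈ s with f l ≠ 0, ‖f l‖ := by
        rw [Finset.sum_filter]
        refine Finset.sum_congr rfl fun l _ => ?_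
        by_cases hl : f l = 0 <;> simp [hl]
    _ ≤ ∑ l ∈ s with f l ≠ 0, C * ‖u (σ l)‖ :=
        Finset.sum_le_sum fun l hl => h l (Finset.mem_filter.1 hl).2
    _ = C * ∑ l ∈ (s.filter fun l => f l ≠ 0).image σ, ‖u l‖ := by
        rw [Finset.sum_image, Finset.mul_sum]
        intro a ha b hb hab
        exact hσ (Finset.mem_filter.1 ha).2 (Finset.mem_filter.1 hb).2 hab
    _ ≤ C * ‖u‖ := mul_le_mul_of_nonneg_left (hu _) hC

theorem memℓp_one_of_dominated {f : ℕ → ℂ} (u : EllOne) {C : ℝ} (hC : 0 ≤ C) (σ : ℕ → ℕ)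
    (hσ : Set.InjOn σ {l | f l ≠ 0}) (h : ∀ l, f l ≠ 0 → ‖f l‖ ≤ C * ‖u (σ l)‖) :
    Memℓp f 1 :=
  memℓp_gen' (C := C * ‖u‖) fun s => by
    simpa using sum_norm_le_of_dominated u hC σ hσ h s

theorem norm_le_of_dominated (w u : EllOne) {C : ℝ} (hC : 0 ≤ C) (σ : ℕ → ℕ)
    (hσ : Set.InjOn σ {l | w l ≠ 0}) (h : ∀ l, w l ≠ 0 → ‖w l‖ ≤ C * ‖u (σ l)‖) :
    ‖w‖ ≤ C * ‖u‖ :=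
  lp.norm_le_of_forall_sum_le (by simp) (by positivity) fun s => by
    simpa using sum_norm_le_of_dominated u hC σ hσ h s

end EllOneRows

/-! ### Coordinates and weighted reindexing operators on the `c₀`-sum. -/

section CZeroSum

theorem CZeroSumEllOne.tendsto_zero (x : CZeroSumEllOne) :
    Tendsto (fun k => x k) atTop (𝓝 0) := by
  have h := x.zero_at_infty'
  rwa [Filter.cocompact_eq_cofinite, Nat.cofinite_eq_atTop] at h

/-- The element of the `c₀`-sum with prescribed rows. -/
def CZeroSumEllOne.ofRows (u : ℕ → EllOne) (h : Tendsto u atTop (𝓝 0)) : CZeroSumEllOne :=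
  ⟨⟨u, continuous_of_discreteTopology⟩, by
    rw [Filter.cocompact_eq_cofinite, Nat.cofinite_eq_atTop]; exact h⟩

@[simp]
theorem CZeroSumEllOne.ofRows_apply (u : ℕ → EllOne) (h : Tendsto u atTop (𝓝 0)) (k : ℕ) :
    CZeroSumEllOne.ofRows u h k = u k := rfl

theorem CZeroSumEllOne.norm_row_le (x : CZeroSumEllOne) (k : ℕ) : ‖x k‖ ≤ ‖x‖ :=
  x.toBCF.norm_coe_le_norm k

theorem CZeroSumEllOne.norm_coord_le (x : CZeroSumEllOne) (k l : ℕ) : ‖x k l‖ ≤ ‖x‖ :=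
  (lp.norm_apply_le_norm one_ne_zero (x k) l).trans (x.norm_row_le k)

theorem CZeroSumEllOne.norm_le_of_rows {x : CZeroSumEllOne} {C : ℝ} (hC : 0 ≤ C)
    (h : ∀ k, ‖x k‖ ≤ C) : ‖x‖ ≤ C :=
  (BoundedContinuousFunction.norm_le (f := x.toBCF) hC).2 h

theorem CZeroSumEllOne.ext_coord {x y : CZeroSumEllOne} (h : ∀ k l, x k l = y k l) : x = y := by
  ext k l
  exact h k l

/-- Bounded operators acting on the coordinates by weighted reindexing. -/
theorem exists_pseudoShift (c : ℕ → ℕ → ℂ) (φ : ℕ → ℕ) (σ : ℕ → ℕ → ℕ) {C : ℝ}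
    (hc : ∀ k l, ‖c k l‖ ≤ C) (hφ : Tendsto φ atTop atTop)
    (hσ : ∀ k, Set.InjOn (σ k) {l | c k l ≠ 0}) :
    ∃ A : CZeroSumEllOne →L[ℂ] CZeroSumEllOne,
      ∀ x k l, A x k l = c k l * x (φ k) (σ k l) := by
  have hC : 0 ≤ C := (norm_nonneg _).trans (hc 0 0)
  have hinj : ∀ (x : CZeroSumEllOne) k,
      Set.InjOn (σ k) {l | c k l * x (φ k) (σ k l) ≠ 0} := fun x k =>
    (hσ k).mono fun l hl => left_ne_zero_of_mul hl
  have hdom : ∀ (x : CZeroSumEllOne) k l, c k l * x (φ k) (σ k l) ≠ 0 →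
      ‖c k l * x (φ k) (σ k l)‖ ≤ C * ‖x (φ k) (σ k l)‖ := fun x k l _ => by
    rw [norm_mul]; exact mul_le_mul_of_nonneg_right (hc k l) (norm_nonneg _)
  let row : CZeroSumEllOne → ℕ → EllOne := fun x k =>
    ⟨fun l => c k l * x (φ k) (σ k l),
      memℓp_one_of_dominated (x (φ k)) hC (σ k) (hinj x k) (hdom x k)⟩
  have hrow : ∀ x k, ‖row x k‖ ≤ C * ‖x (φ k)‖ := fun x k =>
    norm_le_of_dominated (row x k) (x (φ k)) hC (σ k) (hinj x k) (hdom x k)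
  have hlim : ∀ x, Tendsto (row x) atTop (𝓝 0) := fun x => by
    refine squeeze_zero_norm (hrow x) ?_
    -- Divergence of `φ` is what keeps the image in the `c₀`-sum.
    have := ((x.tendsto_zero.comp hφ).norm).const_mul C
    simpa using this
  let A : CZeroSumEllOne →ₗ[ℂ] CZeroSumEllOne :=
    { toFun := fun x => CZeroSumEllOne.ofRows (row x) (hlim x)
      map_add' := fun x y => by
        refine CZeroSumEllOne.ext_coord fun k l => ?_
        exact mul_add (c k l) _ _
      map_smul' := fun a x => by
        refine CZeroSumEllOne.ext_coord fun k l => ?_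
        exact mul_left_comm (c k l) a _ }
  refine ⟨A.mkContinuous C fun x => ?_, fun x k l => rfl⟩
  exact CZeroSumEllOne.norm_le_of_rows (by positivity) fun k =>
    (hrow x k).trans (mul_le_mul_of_nonneg_left (x.norm_row_le _) hC)

/-- The coordinate functionals are continuous. -/
def CZeroSumEllOne.coordCLM (k l : ℕ) : CZeroSumEllOne →L[ℂ] ℂ :=
  LinearMap.mkContinuous
    { toFun := fun x => x k l
      map_add' := fun _ _ => rfl
      map_smul' := fun _ _ => rfl } 1 fun x => by
        rw [one_mul]; exact x.norm_coord_le k l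

@[simp]
theorem CZeroSumEllOne.coordCLM_apply (k l : ℕ) (x : CZeroSumEllOne) :
    CZeroSumEllOne.coordCLM k l x = x k l := rfl

end CZeroSum

/-! ### The shift, the row lifts and the obstruction. -/

section Operators

/-- The weights are consecutive quotients of `l + k + 1`, so powers telescope: growth is linear in
`n` in column 0 and is damped in deep columns. -/
theorem exists_backwardShift : ∃ A : CZeroSumEllOne →L[ℂ] CZeroSumEllOne,
    ∀ x k l, A x k l = ((l + k + 2 : ℂ) / (l + k + 1)) * x (k + 1) l := by
  refine exists_pseudoShift (fun k l => (l + k + 2 : ℂ) / (l + k + 1)) (fun k => k + 1)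
    (fun _ l => l) (C := 2) (fun k l => ?_) (tendsto_add_atTop_nat 1) fun _ => Set.injOn_id _
  have h1 : ((l + k + 2 : ℂ) / (l + k + 1)) = (((l + k + 2 : ℝ) / (l + k + 1) : ℝ) : ℂ) := by
    push_cast; ring
  rw [h1, Complex.norm_real, Real.norm_of_nonneg (by positivity), div_le_iff₀ (by positivity)]
  have : (0 : ℝ) ≤ l := Nat.cast_nonneg l
  have : (0 : ℝ) ≤ k := Nat.cast_nonneg k
  linarith

/-- The weighted backward shift moving rows. -/
def backwardShift : CZeroSumEllOne →L[ℂ] CZeroSumEllOne := exists_backwardShift.choose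

theorem backwardShift_apply (x : CZeroSumEllOne) (k l : ℕ) :
    backwardShift x k l = ((l + k + 2 : ℂ) / (l + k + 1)) * x (k + 1) l :=
  exists_backwardShift.choose_spec x k l

theorem backwardShift_pow_apply (n : ℕ) (x : CZeroSumEllOne) (k l : ℕ) :
    (backwardShift ^ n) x k l = ((l + k + n + 1 : ℂ) / (l + k + 1)) * x (k + n) l := by
  have hne : ∀ j : ℕ, ((l : ℂ) + j + 1) ≠ 0 := fun j => by exact_mod_cast Nat.succ_ne_zero (l + j)
  induction n generalizing k with
  | zero =>
    have := hne k
    simp [div_self this]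
  | succ n ih =>
    rw [pow_succ', mul_apply_eq_comp, backwardShift_apply, ih]
    have h1 := hne k
    have h2 := hne (k + 1)
    have h3 : (l : ℂ) + k + 2 ≠ 0 := by
      intro h; apply h2; push_cast; rw [← h]; ring
    push_cast at h2 ⊢
    rw [show k + 1 + n = k + (n + 1) by ring, ← mul_assoc]
    congr 1
    field_simp
    ring

/-- The depth of the coordinates copied to the top of the `k`-th row. -/
def depth (k : ℕ) : ℕ := Nat.sqrt k + 1

theorem exists_liftRows : ∃ A : CZeroSumEllOne →L[ℂ] CZeroSumEllOne,
    ∀ x k l, A x k l = x k (l + depth k) := by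
  obtain ⟨A, hA⟩ := exists_pseudoShift (fun _ _ => 1) (fun k => k) (fun k l => l + depth k)
    (C := 1) (by simp) tendsto_id fun k => (add_left_injective _).injOn
  exact ⟨A, fun x k l => by rw [hA, one_mul]⟩

/-- The operator shifting the `k`-th row by `depth k`. -/
def liftRows : CZeroSumEllOne →L[ℂ] CZeroSumEllOne := exists_liftRows.choose

theorem liftRows_apply (x : CZeroSumEllOne) (k l : ℕ) :
    liftRows x k l = x k (l + depth k) :=
  exists_liftRows.choose_spec x k l

theorem exists_fastVector : ∃ y : CZeroSumEllOne,
    ∀ k, y k 0 = (depth k + 4 : ℂ) / (k + 1) := by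
  let c : ℕ → ℂ := fun k => (depth k + 4 : ℂ) / (k + 1)
  have hc : ∀ k, ‖c k‖ = (depth k + 4 : ℝ) / (k + 1) := fun k => by
    have h1 : c k = (((depth k + 4 : ℝ) / (k + 1) : ℝ) : ℂ) := by simp [c]
    rw [h1, Complex.norm_real, Real.norm_of_nonneg (by positivity)]
  have hlim : Tendsto (fun k => lp.single (E := fun _ : ℕ => ℂ) 1 0 (c k)) atTop (𝓝 0) := by
    -- The constant is 6 because `depth k + 4 ≤ √(k+1) + 5 ≤ 6 √(k+1)`.
    refine squeeze_zero_norm (a := fun k : ℕ => 6 / √((k + 1 : ℕ) : ℝ)) (fun k => ?_) ?_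
    · rw [lp.norm_single (by simp), hc, div_le_div_iff₀ (by positivity) (by positivity)]
      have h1 : (1 : ℝ) ≤ √((k + 1 : ℕ) : ℝ) := Real.one_le_sqrt.2 (by push_cast; linarith [Nat.cast_nonneg (α := ℝ) k])
      have h2 : (depth k : ℝ) ≤ √((k + 1 : ℕ) : ℝ) + 1 := by
        have : (Nat.sqrt k : ℝ) ≤ √((k + 1 : ℕ) : ℝ) :=
          Real.nat_sqrt_le_real_sqrt.trans (Real.sqrt_le_sqrt (by push_cast; linarith))
        unfold depth; push_cast at this ⊢; linarith
      have h3 : √((k + 1 : ℕ) : ℝ) * √((k + 1 : ℕ) : ℝ) = k + 1 := by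
        rw [Real.mul_self_sqrt (by positivity)]; push_cast; ring
      nlinarith
    · refine tendsto_const_nhds.div_atTop ?_
      exact Real.tendsto_sqrt_atTop.comp
        (tendsto_natCast_atTop_atTop.comp (tendsto_add_atTop_nat 1))
  refine ⟨CZeroSumEllOne.ofRows _ hlim, fun k => ?_⟩
  simp [c]

theorem exists_buryRows : ∃ A : CZeroSumEllOne →L[ℂ] CZeroSumEllOne,
    ∀ x k l, A x k l = if l < depth k then 0 else x k (l - depth k) := by
  -- Truncated subtraction is not injective for `l < depth k`, but the weight is zero there.
  obtain ⟨A, hA⟩ := exists_pseudoShift (fun k l => if l < depth k then 0 else 1) (fun k => k)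
    (fun k l => l - depth k) (C := 1) (fun k l => by split_ifs <;> simp) tendsto_id
    fun k a ha b hb hab => by
      have h1 : ¬ a < depth k := fun h => ha (if_pos h)
      have h2 : ¬ b < depth k := fun h => hb (if_pos h)
      have h3 : a - depth k = b - depth k := hab
      omega
  exact ⟨A, fun x k l => by rw [hA]; split_ifs <;> simp⟩

/-- The right inverse of `liftRows` shifting the `k`-th row forward by `depth k`. -/
def buryRows : CZeroSumEllOne →L[ℂ] CZeroSumEllOne := exists_buryRows.choose

theorem buryRows_apply (x : CZeroSumEllOne) (k l : ℕ) :
    buryRows x k l = if l < depth k then 0 else x k (l - depth k) :=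
  exists_buryRows.choose_spec x k l

theorem liftRows_buryRows (x : CZeroSumEllOne) : liftRows (buryRows x) = x :=
  CZeroSumEllOne.ext_coord fun k l => by simp [liftRows_apply, buryRows_apply]

/-- A vector whose orbit under `backwardShift` grows faster than `depth`. -/
def fastVector : CZeroSumEllOne := exists_fastVector.choose

theorem fastVector_apply (k : ℕ) : fastVector k 0 = (depth k + 4 : ℂ) / (k + 1) :=
  exists_fastVector.choose_spec k

/-- The rank one perturbation of `liftRows` in the direction of `fastVector`. -/
def liftPerturbed : CZeroSumEllOne →L[ℂ] CZeroSumEllOne :=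
  liftRows + (CZeroSumEllOne.coordCLM 0 0).smulRight fastVector

theorem liftPerturbed_apply (x : CZeroSumEllOne) :
    liftPerturbed x = liftRows x + x 0 0 • fastVector := rfl

/-- Both sides see the entry `x n (depth n)`, with weights `n + 1` and `(d + n + 1)/(d + 1)`, `d =
depth n`; the quotient of these is at most `d + 1`. -/
theorem norm_pow_lift_coord_le (n : ℕ) (x : CZeroSumEllOne) :
    ‖(backwardShift ^ n) (liftRows x) 0 0‖ ≤ (depth n + 1) * ‖(backwardShift ^ n) x‖ := by
  have h1 : (backwardShift ^ n) (liftRows x) 0 0 =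
      (((n + 1) * (depth n + 1) / (depth n + n + 1) : ℝ) : ℂ) *
        (backwardShift ^ n) x 0 (depth n) := by
    rw [backwardShift_pow_apply, backwardShift_pow_apply, liftRows_apply]
    have h2 : (depth n : ℂ) + 1 ≠ 0 := by exact_mod_cast Nat.succ_ne_zero (depth n)
    have h3 : (depth n : ℂ) + n + 1 ≠ 0 := by exact_mod_cast Nat.succ_ne_zero (depth n + n)
    push_cast
    simp only [zero_add, add_zero, div_one]
    field_simp
  rw [h1, norm_mul, Complex.norm_real, Real.norm_of_nonneg (by positivity)]
  refine mul_le_mul ?_ (CZeroSumEllOne.norm_coord_le _ _ _) (norm_nonneg _) (by positivity)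
  rw [div_le_iff₀ (by positivity)]
  nlinarith [Nat.cast_nonneg (α := ℝ) (depth n), Nat.cast_nonneg (α := ℝ) n,
    mul_nonneg (Nat.cast_nonneg (α := ℝ) (depth n)) (Nat.cast_nonneg (α := ℝ) (depth n))]

/-- The perturbation contributes at least `depth n + 4` at `(0, 0)` and the lift can cancel at most
`depth n + 1`. -/
theorem one_le_norm_pow_liftPerturbed (n : ℕ) (x : CZeroSumEllOne) (hx : 1 ≤ ‖x 0 0‖)
    (h : ‖(backwardShift ^ n) x‖ ≤ 1) : 1 ≤ ‖(backwardShift ^ n) (liftPerturbed x)‖ := by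
  have h1 : (backwardShift ^ n) (liftPerturbed x) 0 0 =
      (backwardShift ^ n) (liftRows x) 0 0 + x 0 0 * (depth n + 4) := by
    have : (backwardShift ^ n) fastVector 0 0 = depth n + 4 := by
      rw [backwardShift_pow_apply, zero_add, fastVector_apply]
      have h3 : (n : ℂ) + 1 ≠ 0 := by exact_mod_cast Nat.succ_ne_zero n
      simp only [Nat.cast_zero, zero_add, div_one]
      field_simp
    rw [liftPerturbed_apply, map_add, map_smul, ← this]
    rfl
  have h2 := norm_pow_lift_coord_le n x
  have h3 := CZeroSumEllOne.norm_coord_le ((backwardShift ^ n) (liftPerturbed x)) 0 0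
  have h4 : ‖x 0 0 * (depth n + 4)‖ ≤ ‖(backwardShift ^ n) (liftPerturbed x) 0 0‖ +
      ‖(backwardShift ^ n) (liftRows x) 0 0‖ := by
    rw [h1]
    have := norm_sub_le ((backwardShift ^ n) (liftRows x) 0 0 + x 0 0 * (depth n + 4))
      ((backwardShift ^ n) (liftRows x) 0 0)
    rwa [add_sub_cancel_left] at this
  have h5 : ‖x 0 0 * (depth n + 4 : ℂ)‖ = ‖x 0 0‖ * (depth n + 4) := by
    have : (depth n + 4 : ℂ) = ((depth n + 4 : ℝ) : ℂ) := by push_cast; rfl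
    rw [norm_mul, this, Complex.norm_real, Real.norm_of_nonneg (by positivity)]
  have h6 : (0 : ℝ) ≤ depth n := Nat.cast_nonneg _
  nlinarith

end Operators

/-! ### Finitely supported targets and separability. -/

section FiniteSupport

/-- The vectors with finitely many non-zero coordinates. -/
def finitelySupported : Set CZeroSumEllOne :=
  {u | ∃ r : ℕ, ∀ k l, r ≤ k ∨ r ≤ l → u k l = 0}

theorem exists_finite_support_near (w : EllOne) {ε : ℝ} (hε : 0 < ε) :
    ∃ (v : EllOne) (R : ℕ), (∀ l, R ≤ l → v l = 0) ∧ ‖v - w‖ ≤ ε := by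
  have h := lp.hasSum_single (p := 1) ENNReal.one_ne_top w
  obtain ⟨s, hs⟩ := (Metric.tendsto_atTop.1 h) ε hε
  refine ⟨∑ l ∈ s, lp.single 1 l (w l), s.sup id + 1, fun l hl => ?_, ?_⟩
  · rw [lp.coeFn_sum, Finset.sum_apply]
    refine Finset.sum_eq_zero fun j hj => ?_
    have : j ≤ s.sup id := Finset.le_sup (f := id) hj
    have hne : l ≠ j := by omega
    simp [hne]
  · have := hs s le_rfl
    rw [dist_eq_norm] at this
    exact this.le

theorem dense_finitelySupported : Dense finitelySupported := by
  rw [Metric.dense_iff]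
  intro u ε hε
  obtain ⟨K, hK⟩ := Metric.tendsto_atTop.1 u.tendsto_zero (ε / 2) (by positivity)
  choose w R hR hw using fun k => exists_finite_support_near (u k) (half_pos hε)
  have hlim : Tendsto (fun k => if k < K then w k else 0) atTop (𝓝 0) := by
    refine tendsto_const_nhds.congr' ?_
    filter_upwards [eventually_ge_atTop K] with k hk
    rw [if_neg (by omega)]
  refine ⟨CZeroSumEllOne.ofRows _ hlim, ?_, max K ((Finset.range K).sup R), fun k l h => ?_⟩
  · rw [Metric.mem_ball, dist_eq_norm]
    refine lt_of_le_of_lt ?_ (half_lt_self hε)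
    refine CZeroSumEllOne.norm_le_of_rows (by positivity) fun k => ?_
    change ‖(if k < K then w k else 0) - u k‖ ≤ ε / 2
    split_ifs with hk
    · exact hw k
    · have := hK k (by omega)
      rw [dist_zero_right] at this
      rw [zero_sub, norm_neg]
      exact this.le
  · rw [CZeroSumEllOne.ofRows_apply]
    split_ifs with hk
    · refine hR k l ?_
      have : R k ≤ (Finset.range K).sup R := Finset.le_sup (Finset.mem_range.2 hk)
      omega
    · rfl

/-- The canonical unit vectors. -/
def unitVector (k l : ℕ) : CZeroSumEllOne :=
  CZeroSumEllOne.ofRows (Pi.single k (lp.single 1 l 1)) <| by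
    refine tendsto_const_nhds.congr' ?_
    filter_upwards [eventually_gt_atTop k] with j hj
    rw [Pi.single_eq_of_ne (by omega)]

theorem unitVector_apply (k l i j : ℕ) :
    unitVector k l i j = if i = k ∧ j = l then 1 else 0 := by
  unfold unitVector
  rw [CZeroSumEllOne.ofRows_apply]
  by_cases hi : i = k
  · subst hi
    by_cases hj : j = l
    · subst hj; simp
    · simp [hj]
  · rw [Pi.single_eq_of_ne hi]; simp [hi]

theorem finitelySupported_subset_span : finitelySupported ⊆
    Submodule.span ℂ (Set.range fun p : ℕ × ℕ => unitVector p.1 p.2) := by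
  rintro u ⟨r, hr⟩
  have hu : u = ∑ p ∈ Finset.range r ×ˢ Finset.range r, u p.1 p.2 • unitVector p.1 p.2 := by
    refine CZeroSumEllOne.ext_coord fun i j => ?_
    rw [← CZeroSumEllOne.coordCLM_apply i j (∑ p ∈ _, _), map_sum]
    have : ∀ p ∈ Finset.range r ×ˢ Finset.range r,
        CZeroSumEllOne.coordCLM i j (u p.1 p.2 • unitVector p.1 p.2) =
          if p = (i, j) then u i j else 0 := fun p _ => by
      rw [map_smul, CZeroSumEllOne.coordCLM_apply, unitVector_apply]
      by_cases hp : p = (i, j)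
      · subst hp; simp
      · have : ¬ (i = p.1 ∧ j = p.2) := fun h => hp (Prod.ext h.1.symm h.2.symm)
        simp [hp, this]
    rw [Finset.sum_congr rfl this, Finset.sum_ite_eq']
    split_ifs with h
    · rfl
    · simp only [Finset.mem_product, Finset.mem_range] at h
      exact hr i j (by omega)
  rw [hu]
  exact Submodule.sum_mem _ fun p _ => Submodule.smul_mem _ _ (Submodule.subset_span ⟨p, rfl⟩)

instance : TopologicalSpace.SeparableSpace CZeroSumEllOne := by
  rw [← TopologicalSpace.isSeparable_univ_iff, ← dense_finitelySupported.closure_eq]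
  exact ((Set.countable_range _).isSeparable.span (R := ℂ) |>.mono
    finitelySupported_subset_span).closure

end FiniteSupport

/-- A sequence of finitely supported vectors whose supports and norms grow slowly. -/
structure IsSlowFamily (P : ℕ → CZeroSumEllOne) (r : ℕ → ℕ) : Prop where
  growth : ∀ q, r q ^ 4 ≤ q
  supp : ∀ q k l, r q ≤ k ∨ r q ≤ l → P q k l = 0
  norm_le : ∀ q, ‖P q‖ ≤ r q

/-- A dense sequence of finitely supported pairs is enumerated with infinite repetition, replaced by
zero until the index exceeds the fourth power of the size. Each pair thus recurs at arbitrarily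
large labels with bounded size. -/
theorem exists_dense_slowFamilies : ∃ (P Q : ℕ → CZeroSumEllOne) (r : ℕ → ℕ),
    IsSlowFamily P r ∧ IsSlowFamily Q r ∧
    ∀ V : Set (CZeroSumEllOne × CZeroSumEllOne), IsOpen V → V.Nonempty →
      ∃ z ∈ V, ∃ R, ∀ M, ∃ v, M ≤ v ∧ (P v, Q v) = z ∧ r v ≤ R := by
  have : SecondCountableTopology CZeroSumEllOne :=
    UniformSpace.secondCountable_of_separable _
  let F := finitelySupported ×ˢ finitelySupported
  have hF : Dense F := dense_finitelySupported.prod dense_finitelySupported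
  have : Nonempty F := hF.nonempty.to_subtype
  let D : ℕ → F := TopologicalSpace.denseSeq F
  have hsize : ∀ a, ∃ R : ℕ, (∀ k l, R ≤ k ∨ R ≤ l → (D a).1.1 k l = 0) ∧
      (∀ k l, R ≤ k ∨ R ≤ l → (D a).1.2 k l = 0) ∧ ‖(D a).1.1‖ ≤ R ∧ ‖(D a).1.2‖ ≤ R := by
    intro a
    obtain ⟨⟨r₁, h₁⟩, r₂, h₂⟩ := (D a).2
    refine ⟨max (max r₁ r₂) (max ⌈‖(D a).1.1‖⌉₊ ⌈‖(D a).1.2‖⌉₊), fun k l h => h₁ k l (by omega),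
      fun k l h => h₂ k l (by omega), ?_, ?_⟩
    · refine (Nat.le_ceil _).trans (Nat.cast_le.2 (by omega))
    · refine (Nat.le_ceil _).trans (Nat.cast_le.2 (by omega))
  choose ρ h₁ h₂ h₃ h₄ using hsize
  let a : ℕ → ℕ := fun v => (Nat.unpair v).1
  refine ⟨fun v => if ρ (a v) ^ 4 ≤ v then (D (a v)).1.1 else 0,
    fun v => if ρ (a v) ^ 4 ≤ v then (D (a v)).1.2 else 0,
    fun v => if ρ (a v) ^ 4 ≤ v then ρ (a v) else 0,
    ⟨fun q => ?_, fun q k l => ?_, fun q => ?_⟩, ⟨fun q => ?_, fun q k l => ?_, fun q => ?_⟩,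
    fun V hV hVne => ?_⟩
  · split_ifs with h
    · exact h
    · simp
  · beta_reduce; split_ifs with h
    · exact h₁ _ k l
    · exact fun _ => rfl
  · split_ifs with h
    · exact h₃ _
    · simp
  · split_ifs with h
    · exact h
    · simp
  · beta_reduce; split_ifs with h
    · exact h₂ _ k l
    · exact fun _ => rfl
  · split_ifs with h
    · exact h₄ _
    · simp
  · have hVF : ((↑) ⁻¹' V : Set F).Nonempty := by
      obtain ⟨z, hz, hzF⟩ := hF.inter_open_nonempty V hV hVne
      exact ⟨⟨z, hzF⟩, hz⟩
    obtain ⟨_, hzV, b, rfl⟩ := (TopologicalSpace.denseRange_denseSeq F).inter_open_nonempty _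
      (hV.preimage continuous_subtype_val) hVF
    refine ⟨_, hzV, ρ b, fun M => ?_⟩
    refine ⟨Nat.pair b (max M (ρ b ^ 4)), ?_, ?_, ?_⟩
    · exact (le_max_left _ _).trans (Nat.right_le_pair _ _)
    · have h : ρ b ^ 4 ≤ Nat.pair b (max M (ρ b ^ 4)) :=
        (le_max_right _ _).trans (Nat.right_le_pair _ _)
      simp [a, h, D]
    · have h : ρ b ^ 4 ≤ Nat.pair b (max M (ρ b ^ 4)) :=
        (le_max_right _ _).trans (Nat.right_le_pair _ _)
      simp [a, h]

/-! ### Separated patches and lower density. -/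

section Times

/-- The label of the `t`-th patch. -/
def label (t : ℕ) : ℕ := padicValNat 2 (t + 1)

/-- The starting time of the `t`-th patch. -/
def startTime (t : ℕ) : ℕ := ∑ s ∈ Finset.range t, ((label s + 1) + (label (s + 1) + 1))

theorem startTime_succ (t : ℕ) :
    startTime (t + 1) = startTime t + ((label t + 1) + (label (t + 1) + 1)) :=
  Finset.sum_range_succ _ _

theorem startTime_strictMono : StrictMono startTime :=
  strictMono_nat_of_lt_succ fun t => by rw [startTime_succ]; omega

theorem startTime_gap {t u : ℕ} (h : t < u) :
    startTime t + (label t + 1) + (label u + 1) ≤ startTime u := by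
  have h1 := startTime_succ (u - 1)
  rw [show u - 1 + 1 = u by omega] at h1
  rcases eq_or_lt_of_le (show t ≤ u - 1 by omega) with h2 | h2
  · subst h2; omega
  · have h3 := startTime_strictMono.monotone (show t + 1 ≤ u - 1 by omega)
    have h4 := startTime_succ t
    omega

/-- By Legendre's formula the sum is the 2-adic valuation of `t!`. Hence labels are bounded on
average and start times grow linearly. -/
theorem sum_label_le (t : ℕ) : ∑ s ∈ Finset.range t, label s ≤ t := by
  have h : ∑ s ∈ Finset.range t, label s = padicValNat 2 t.factorial := by
    induction t with
    | zero => simp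
    | succ t ih =>
      rw [Finset.sum_range_succ, ih, Nat.factorial_succ,
        padicValNat.mul (by omega) (Nat.factorial_ne_zero t), add_comm]
      rfl
  have h2 := sub_one_mul_padicValNat_factorial (p := 2) t
  rw [h]
  omega

theorem startTime_le (t : ℕ) : startTime t ≤ 4 * (t + 1) := by
  have h : startTime t = ∑ s ∈ Finset.range t, label s + ∑ s ∈ Finset.range t, label (s + 1)
      + 2 * t := by
    unfold startTime
    simp only [Finset.sum_add_distrib, Finset.sum_const, Finset.card_range, smul_eq_mul]
    ring
  have h1 := sum_label_le t
  have h2 := sum_label_le (t + 1)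
  rw [Finset.sum_range_succ'] at h2
  omega

theorem label_le_startTime (t : ℕ) : label t ≤ startTime t := by
  have h1 : t ≤ startTime t := startTime_strictMono.le_apply
  have h2 : 2 ^ label t ≤ t + 1 := Nat.le_of_dvd (by omega) pow_padicValNat_dvd
  have h3 : label t < 2 ^ label t := Nat.lt_two_pow_self
  omega

/-- The index of the patch covering `k`. -/
def patchIndex (k : ℕ) : ℕ := Nat.findGreatest (fun t => startTime t ≤ k) k

theorem startTime_patchIndex_le (k : ℕ) : startTime (patchIndex k) ≤ k :=
  Nat.findGreatest_spec (P := fun t => startTime t ≤ k) (Nat.zero_le k) (Nat.zero_le k)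

theorem le_patchIndex {t k : ℕ} (h : startTime t ≤ k) : t ≤ patchIndex k :=
  Nat.le_findGreatest ((startTime_strictMono.le_apply).trans h) h

theorem label_two_pow_mul (v j : ℕ) : label (2 ^ v * (2 * j + 1) - 1) = v := by
  have h : 0 < 2 ^ v * (2 * j + 1) := by positivity
  unfold label
  rw [Nat.sub_add_cancel h, padicValNat.mul (by positivity) (by omega), padicValNat.prime_pow,
    padicValNat.eq_zero_of_not_dvd (by omega), add_zero]

theorem lowerDensity_pos_of_strictMono {A : Set ℕ} {b : ℕ → ℕ} (hb : StrictMono b)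
    (hbA : ∀ j, b j ∈ A) {K : ℕ} (hbK : ∀ j, b j < K * (j + 1)) : 0 < lowerDensity A := by
  have hK : 0 < K := Nat.pos_of_ne_zero fun h => by simpa [h] using hbK 0
  have hcard : ∀ N, N / K ≤ (A ∩ Set.Iio N).ncard := fun N => by
    have hsub : b '' (Finset.range (N / K) : Set ℕ) ⊆ A ∩ Set.Iio N := by
      rintro _ ⟨j, hj, rfl⟩
      refine ⟨hbA j, (hbK j).trans_le ?_⟩
      have hj' : j + 1 ≤ N / K := by simpa using hj
      exact (Nat.mul_le_mul_left K hj').trans (Nat.mul_div_le N K)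
    have := Set.ncard_le_ncard hsub ((Set.finite_Iio N).inter_of_right A)
    rwa [Set.ncard_image_of_injective _ hb.injective, Set.ncard_coe_finset,
      Finset.card_range] at this
  have hK' : (0 : ℝ) < K := Nat.cast_pos.2 hK
  refine (show (0 : ℝ) < 1 / (2 * K) by positivity).trans_le ?_
  refine le_liminf_of_le ?_ ?_
  -- The real-valued `liminf` needs this bound to be meaningful.
  · refine isCoboundedUnder_ge_of_le (x := 1) _ fun N => ?_
    refine div_le_one_of_le₀ ?_ (Nat.cast_nonneg _)
    have := Set.ncard_le_ncard (Set.inter_subset_right (s := A) (t := Set.Iio N))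
      (Set.finite_Iio N)
    rw [Set.ncard_eq_toFinset_card' (Set.Iio N)] at this
    simpa using this
  · filter_upwards [eventually_ge_atTop (2 * K)] with N hN
    have hN' : (2 * K : ℝ) ≤ N := by exact_mod_cast hN
    rw [div_le_div_iff₀ (by positivity) (by linarith)]
    have h1 : (N : ℝ) < (K : ℝ) * ((N / K : ℕ) + 1) := by
      exact_mod_cast Nat.lt_mul_div_succ N hK
    have h2 : ((N / K : ℕ) : ℝ) ≤ (A ∩ Set.Iio N).ncard := Nat.cast_le.2 (hcard N)
    nlinarith

/-- Label `v` occurs exactly when `t + 1` is `2 ^ v` times an odd number, and start times are at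
most `4 (t + 1)`. -/
theorem lowerDensity_pos_of_label {A : Set ℕ} (v : ℕ)
    (hA : ∀ t, label t = v → startTime t ∈ A) : 0 < lowerDensity A := by
  refine lowerDensity_pos_of_strictMono (b := fun j => startTime (2 ^ v * (2 * j + 1) - 1))
    (K := 8 * 2 ^ v) (fun i j hij => ?_) (fun j => hA _ (label_two_pow_mul v j)) fun j => ?_
  · refine startTime_strictMono ?_
    have : 2 ^ v * (2 * i + 1) < 2 ^ v * (2 * j + 1) :=
      Nat.mul_lt_mul_of_pos_left (by omega) (by positivity)
    have : 0 < 2 ^ v * (2 * i + 1) := by positivity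
    omega
  · have h := startTime_le (2 ^ v * (2 * j + 1) - 1)
    have h0 : 0 < 2 ^ v * (2 * j + 1) := by positivity
    rw [Nat.sub_add_cancel h0] at h
    have h1 : 0 < 2 ^ v := by positivity
    refine h.trans_lt ?_
    nlinarith

end Times

/-! ### Placing targets in patches, with error estimates. -/

section Patches

variable {P Q : ℕ → CZeroSumEllOne} {r : ℕ → ℕ}

/-- The position of `k` inside the patch covering it. -/
def offset (k : ℕ) : ℕ := k - startTime (patchIndex k)

theorem startTime_patchIndex_add_offset (k : ℕ) : startTime (patchIndex k) + offset k = k :=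
  Nat.add_sub_of_le (startTime_patchIndex_le k)

theorem label_patchIndex_le (k : ℕ) : label (patchIndex k) ≤ k :=
  (label_le_startTime _).trans (startTime_patchIndex_le k)

namespace IsSlowFamily

/-- AM-GM with `r q ^ 4 ≤ q`. It turns the separation `p + q + 2` of two patches into an error
`1/√(p + 1)` uniform in `q`. -/
theorem sq_mul_sqrt_le (hP : IsSlowFamily P r) (p q : ℕ) :
    (r q : ℝ) ^ 2 * √(p + 1) ≤ p + q + 2 := by
  have h1 : (r q : ℝ) ^ 4 ≤ q := by exact_mod_cast hP.growth q
  have h2 : √((p : ℝ) + 1) ^ 2 = p + 1 := Real.sq_sqrt (by positivity)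
  nlinarith [sq_nonneg ((r q : ℝ) ^ 2 - √(p + 1)), Nat.cast_nonneg (α := ℝ) q,
    Nat.cast_nonneg (α := ℝ) p]

theorem mul_self_le (hP : IsSlowFamily P r) (q : ℕ) : r q * r q ≤ q := by
  refine le_trans ?_ (hP.growth q)
  rcases Nat.eq_zero_or_pos (r q) with h | h
  · simp [h]
  · calc r q * r q = r q ^ 2 := by ring
      _ ≤ r q ^ 4 := Nat.pow_le_pow_right h (by norm_num)

theorem le_self (hP : IsSlowFamily P r) (q : ℕ) : r q ≤ q :=
  (Nat.le_mul_self _).trans (hP.mul_self_le q)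

theorem le_depth (hP : IsSlowFamily P r) (k : ℕ) : r (label (patchIndex k)) ≤ depth k := by
  have : r (label (patchIndex k)) ≤ Nat.sqrt k :=
    Nat.le_sqrt.2 ((hP.mul_self_le _).trans (label_patchIndex_le k))
  unfold depth
  omega

/-- One factor `r q` comes from the weight on the support, the other from the norm of `P q`. -/
theorem norm_row_le_of_dominated (hP : IsSlowFamily P r) (w : EllOne) (q i : ℕ) {C D : ℝ}
    (hC : 0 ≤ C) (σ : ℕ → ℕ) (hσ : Set.InjOn σ {l | w l ≠ 0})
    (h : ∀ l, w l ≠ 0 → i < r q → σ l < r q → ‖w l‖ ≤ C * r q * ‖P q i (σ l)‖)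
    (h0 : ∀ l, P q i (σ l) = 0 → w l = 0) (hCD : C * (r q : ℝ) ^ 2 ≤ D) : ‖w‖ ≤ D := by
  have h1 : ‖w‖ ≤ C * r q * ‖P q i‖ := by
    refine norm_le_of_dominated w (P q i) (by positivity) σ hσ fun l hl => ?_
    have hne : P q i (σ l) ≠ 0 := fun h => hl (h0 l h)
    refine h l hl ?_ ?_
    · by_contra hi
      exact hne (hP.supp q i _ (Or.inl (not_lt.1 hi)))
    · by_contra hi
      exact hne (hP.supp q i _ (Or.inr (not_lt.1 hi)))
  refine h1.trans (le_trans ?_ hCD)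
  have h2 : ‖P q i‖ ≤ r q := ((P q).norm_row_le i).trans (hP.norm_le q)
  calc C * r q * ‖P q i‖ ≤ C * r q * r q := mul_le_mul_of_nonneg_left h2 (by positivity)
    _ = C * (r q : ℝ) ^ 2 := by ring

/-- The factor is the inverse of the weight `B` accumulates from row `k` back to row `offset k`, so
the target reappears exactly at its start time. -/
theorem exists_placed (hP : IsSlowFamily P r) : ∃ x : CZeroSumEllOne, ∀ k l,
    x k l = (((l + offset k + 1) / (l + k + 1) : ℝ) : ℂ) *
      P (label (patchIndex k)) (offset k) l := by
  let c : ℕ → ℕ → ℝ := fun k l => (l + offset k + 1) / (l + k + 1)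
  have hc0 : ∀ k l, 0 ≤ c k l := fun k l => by positivity
  have hc1 : ∀ k l, c k l ≤ 1 := fun k l => by
    refine div_le_one_of_le₀ ?_ (by positivity)
    have h1 : offset k ≤ k := Nat.sub_le _ _
    have h2 : (offset k : ℝ) ≤ k := Nat.cast_le.2 h1
    linarith
  let row : ℕ → EllOne := fun k =>
    ⟨fun l => (c k l : ℂ) * P (label (patchIndex k)) (offset k) l,
      memℓp_one_of_dominated (P (label (patchIndex k)) (offset k)) zero_le_one id
        (Set.injOn_id _) fun l _ => by
          rw [norm_mul, Complex.norm_real, Real.norm_of_nonneg (hc0 k l)]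
          exact mul_le_mul_of_nonneg_right (hc1 k l) (norm_nonneg _)⟩
  have hrow : ∀ k, ‖row k‖ ≤ 2 / √(k + 1) := fun k => by
    refine hP.norm_row_le_of_dominated (row k) (label (patchIndex k)) (offset k)
      (C := 2 / (k + 1)) (by positivity) id (Set.injOn_id _) (fun l _ hi hl => ?_)
      (fun l hl => ?_) ?_
    · change ‖(c k l : ℂ) * P (label (patchIndex k)) (offset k) l‖ ≤ _
      rw [norm_mul, Complex.norm_real, Real.norm_of_nonneg (hc0 k l)]
      refine mul_le_mul_of_nonneg_right ?_ (norm_nonneg _)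
      have hi' : (offset k : ℝ) + 1 ≤ r (label (patchIndex k)) := by exact_mod_cast hi
      have hl' : (l : ℝ) + 1 ≤ r (label (patchIndex k)) := by exact_mod_cast hl
      rw [div_mul_eq_mul_div]
      exact div_le_div₀ (by positivity) (by linarith) (by positivity)
        (by linarith [Nat.cast_nonneg (α := ℝ) l])
    · change (c k l : ℂ) * P (label (patchIndex k)) (offset k) l = 0
      rw [show P (label (patchIndex k)) (offset k) l = 0 from hl, mul_zero]
    · have h1 : (r (label (patchIndex k)) : ℝ) ^ 4 ≤ k := by
        exact_mod_cast (hP.growth _).trans (label_patchIndex_le k)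
      have h2 : √((k : ℝ) + 1) ^ 2 = k + 1 := Real.sq_sqrt (by positivity)
      have h3 : (r (label (patchIndex k)) : ℝ) ^ 2 ≤ √((k : ℝ) + 1) :=
        Real.le_sqrt_of_sq_le (by nlinarith)
      have h4 : 0 < √((k : ℝ) + 1) := Real.sqrt_pos.2 (by positivity)
      rw [div_mul_eq_mul_div, div_le_div_iff₀ (by positivity) h4]
      nlinarith
  have hlim : Tendsto row atTop (𝓝 0) := by
    refine squeeze_zero_norm hrow (tendsto_const_nhds.div_atTop ?_)
    refine Real.tendsto_sqrt_atTop.comp ?_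
    exact tendsto_atTop_add_const_right _ _ tendsto_natCast_atTop_atTop
  exact ⟨CZeroSumEllOne.ofRows row hlim, fun k l => rfl⟩

/-- The vector whose orbit under `backwardShift` approximates the members of a slow family. -/
def placed (hP : IsSlowFamily P r) : CZeroSumEllOne := hP.exists_placed.choose

theorem placed_apply (hP : IsSlowFamily P r) (k l : ℕ) :
    hP.placed k l = (((l + offset k + 1) / (l + k + 1) : ℝ) : ℂ) *
      P (label (patchIndex k)) (offset k) l :=
  hP.exists_placed.choose_spec k l

theorem placed_zero (hP : IsSlowFamily P r) : hP.placed 0 0 = 0 := by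
  rw [placed_apply, hP.supp _ _ _ (Or.inl ?_), mul_zero]
  have := label_patchIndex_le 0
  have := hP.le_self (label (patchIndex 0))
  omega

theorem liftRows_placed (hP : IsSlowFamily P r) : liftRows hP.placed = 0 := by
  refine CZeroSumEllOne.ext_coord fun k l => ?_
  rw [liftRows_apply, placed_apply, hP.supp _ _ _ (Or.inr ?_), mul_zero]
  · rfl
  · exact (hP.le_depth k).trans (Nat.le_add_left _ _)

theorem pow_placed_apply (hP : IsSlowFamily P r) (n i l : ℕ) :
    (backwardShift ^ n) hP.placed i l =
      (((l + offset (i + n) + 1) / (l + i + 1) : ℝ) : ℂ) *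
        P (label (patchIndex (i + n))) (offset (i + n)) l := by
  rw [backwardShift_pow_apply, placed_apply, ← mul_assoc]
  congr 1
  have h1 : (l : ℂ) + i + 1 ≠ 0 := by exact_mod_cast Nat.succ_ne_zero (l + i)
  have h2 : (l : ℂ) + (i + n) + 1 ≠ 0 := by exact_mod_cast Nat.succ_ne_zero (l + (i + n))
  have h3 : (l : ℂ) + i + n + 1 ≠ 0 := by rwa [← add_assoc] at h2
  push_cast
  field_simp
  ring

/-- A row seen at a starting time either belongs to the current patch or is far from the patch
covering it. -/
theorem patch_dichotomy (t i : ℕ) :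
    (patchIndex (i + startTime t) = t ∧ offset (i + startTime t) = i) ∨
      offset (i + startTime t) + label t + label (patchIndex (i + startTime t)) + 2 ≤ i := by
  have h1 := startTime_patchIndex_add_offset (i + startTime t)
  rcases (le_patchIndex (Nat.le_add_left (startTime t) i)).eq_or_lt with h | h
  · left
    rw [← h] at h1
    exact ⟨h.symm, by omega⟩
  · right
    have := startTime_gap h
    omega

/-- The current patch is reproduced exactly; each later patch is seen at a row `i` beyond the gap,
where its weight is at most `2 r q / (i + 1)`. -/
theorem norm_pow_placed_sub_le (hP : IsSlowFamily P r) (t : ℕ) :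
    ‖(backwardShift ^ startTime t) hP.placed - P (label t)‖ ≤ 2 / √(label t + 1) := by
  refine CZeroSumEllOne.norm_le_of_rows (by positivity) fun i => ?_
  have hw : ∀ l, ((backwardShift ^ startTime t) hP.placed - P (label t)) i l =
      (backwardShift ^ startTime t) hP.placed i l - P (label t) i l := fun l => rfl
  rcases patch_dichotomy t i with ⟨h1, h2⟩ | h
  · have : ((backwardShift ^ startTime t) hP.placed - P (label t)) i = 0 := by
      ext l
      have h3 : (l : ℝ) + i + 1 ≠ 0 := by positivity
      rw [hw, pow_placed_apply, h1, h2, div_self h3]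
      simp
    rw [this, norm_zero]
    positivity
  · set q := label (patchIndex (i + startTime t)) with hq
    set o := offset (i + startTime t) with ho
    have hw' : ∀ l, ((backwardShift ^ startTime t) hP.placed - P (label t)) i l =
        (((l + o + 1) / (l + i + 1) : ℝ) : ℂ) * P q o l := fun l => by
      have := hP.le_self (label t)
      rw [hw, pow_placed_apply, hP.supp (label t) i l (Or.inl (by omega)), sub_zero]
    have hi : (label t : ℝ) + q + 2 ≤ i := by
      have : label t + q + 2 ≤ i := by omega
      exact_mod_cast this
    refine hP.norm_row_le_of_dominated _ q o (C := 2 / (i + 1)) (by positivity) id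
      (Set.injOn_id _) (fun l _ hor hlr => ?_) (fun l hl => ?_) ?_
    · rw [hw', norm_mul, Complex.norm_real, Real.norm_of_nonneg (by positivity)]
      refine mul_le_mul_of_nonneg_right ?_ (norm_nonneg _)
      have hor' : (o : ℝ) + 1 ≤ r q := by exact_mod_cast hor
      have hlr' : (l : ℝ) + 1 ≤ r q := by exact_mod_cast hlr
      rw [div_mul_eq_mul_div]
      exact div_le_div₀ (by positivity) (by linarith) (by positivity)
        (by linarith [Nat.cast_nonneg (α := ℝ) l])
    · rw [hw', show P q o l = 0 from hl, mul_zero]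
    · have h4 : 0 < √((label t : ℝ) + 1) := Real.sqrt_pos.2 (by positivity)
      rw [div_mul_eq_mul_div, div_le_div_iff₀ (by positivity) h4]
      nlinarith [hP.sq_mul_sqrt_le (label t) q]

theorem pow_bury_placed_apply (hP : IsSlowFamily P r) (n i l : ℕ) (h : depth (i + n) ≤ l) :
    (backwardShift ^ n) (buryRows hP.placed) i l =
      ((((l + i + n + 1) / (l + i + 1)) *
        (((l - depth (i + n) : ℕ) + offset (i + n) + 1) /
          ((l - depth (i + n) : ℕ) + (i + n) + 1)) : ℝ) : ℂ) *
        P (label (patchIndex (i + n))) (offset (i + n)) (l - depth (i + n)) := by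
  rw [backwardShift_pow_apply, buryRows_apply, if_neg (not_lt.2 h), placed_apply, ← mul_assoc]
  push_cast
  rfl

theorem sqrt_le_depth (k : ℕ) : √((k : ℝ) + 1) ≤ depth k := by
  refine Real.sqrt_le_iff.2 ⟨Nat.cast_nonneg _, ?_⟩
  have : k + 1 ≤ depth k ^ 2 := by
    have := Nat.lt_succ_sqrt k
    unfold depth
    rw [pow_two]
    exact this
  exact_mod_cast this

/-- The weight of a buried coordinate. -/
theorem buried_weight_le {m d i n o ρ : ℝ} (hm : 0 ≤ m) (hd : 0 ≤ d) (hi : 0 ≤ i) (hn : 0 ≤ n)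
    (ho : 0 ≤ o) (hoρ : o + 1 ≤ ρ) (hmρ : m + 1 ≤ ρ) :
    (m + d + i + n + 1) / (m + d + i + 1) * ((m + o + 1) / (m + (i + n) + 1)) ≤
      2 * (1 / (d + i + 1) + 1 / (i + n + 1)) * ρ := by
  have h1 : (m + d + i + n + 1) / ((m + d + i + 1) * (m + (i + n) + 1)) ≤
      -- The numerator is at most the sum of the two factors of the denominator.
      1 / (d + i + 1) + 1 / (i + n + 1) := by
    calc (m + d + i + n + 1) / ((m + d + i + 1) * (m + (i + n) + 1))
        ≤ ((m + d + i + 1) + (m + (i + n) + 1)) / ((m + d + i + 1) * (m + (i + n) + 1)) :=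
          div_le_div_of_nonneg_right (by linarith) (by positivity)
      _ = 1 / (m + d + i + 1) + 1 / (m + (i + n) + 1) := by field_simp; ring
      _ ≤ 1 / (d + i + 1) + 1 / (i + n + 1) :=
          add_le_add (one_div_le_one_div_of_le (by positivity) (by linarith))
            (one_div_le_one_div_of_le (by positivity) (by linarith))
  calc (m + d + i + n + 1) / (m + d + i + 1) * ((m + o + 1) / (m + (i + n) + 1))
      = (m + d + i + n + 1) / ((m + d + i + 1) * (m + (i + n) + 1)) * (m + o + 1) := by
        field_simp
    _ ≤ (1 / (d + i + 1) + 1 / (i + n + 1)) * (2 * ρ) :=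
        mul_le_mul h1 (by linarith) (by positivity) (by positivity)
    _ = 2 * (1 / (d + i + 1) + 1 / (i + n + 1)) * ρ := by ring

/-- For later patches the gap gives smallness, as for `placed`. In the current patch it comes from
the depth, at least `√(i + n + 1)`, and from `label t ≤ n`. -/
theorem norm_pow_bury_placed_le (hP : IsSlowFamily P r) (t : ℕ) :
    ‖(backwardShift ^ startTime t) (buryRows hP.placed)‖ ≤
      4 * ((r (label t) : ℝ) ^ 2 + 1) / √(label t + 1) := by
  refine CZeroSumEllOne.norm_le_of_rows (by positivity) fun i => ?_
  set n := startTime t with hn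
  set q := label (patchIndex (i + n)) with hq
  set o := offset (i + n) with ho
  set d := depth (i + n) with hd
  have hzero : ∀ l, l < d → (backwardShift ^ n) (buryRows hP.placed) i l = 0 := fun l hl => by
    rw [backwardShift_pow_apply, buryRows_apply, if_pos hl, mul_zero]
  have hs : 0 < √((label t : ℝ) + 1) := Real.sqrt_pos.2 (by positivity)
  refine hP.norm_row_le_of_dominated _ q o
    (C := 2 * (1 / ((d : ℝ) + i + 1) + 1 / ((i : ℝ) + n + 1))) (by positivity) (fun l => l - d)
    (fun a ha b hb hab => ?_) (fun l hl hor hlr => ?_) (fun l hl => ?_) ?_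
  · have h1 : ¬ a < d := fun h => ha (hzero a h)
    have h2 : ¬ b < d := fun h => hb (hzero b h)
    have h3 : a - d = b - d := hab
    omega
  · have hdl : d ≤ l := not_lt.1 fun h => hl (hzero l h)
    rw [hP.pow_bury_placed_apply n i l hdl, norm_mul, Complex.norm_real,
      Real.norm_of_nonneg (by positivity)]
    refine mul_le_mul_of_nonneg_right ?_ (norm_nonneg _)
    have hor' : (o : ℝ) + 1 ≤ r q := by exact_mod_cast hor
    have hlr' : ((l - d : ℕ) : ℝ) + 1 ≤ r q := by exact_mod_cast hlr
    have hl' : (l : ℝ) = (l - d : ℕ) + d := by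
      rw [← Nat.cast_add, Nat.sub_add_cancel hdl]
    rw [hl']
    exact buried_weight_le (Nat.cast_nonneg _) (Nat.cast_nonneg _) (Nat.cast_nonneg _)
      (Nat.cast_nonneg _) (Nat.cast_nonneg _) hor' hlr'
  · rcases lt_or_ge l d with h | h
    · exact hzero l h
    · rw [hP.pow_bury_placed_apply n i l h, show P _ _ (l - depth (i + n)) = 0 from hl, mul_zero]
  · rcases patch_dichotomy t i with ⟨h1, -⟩ | h
    · have hqt : q = label t := by rw [hq, h1]
      have hp : (label t : ℝ) ≤ i + n := by
        exact_mod_cast (label_le_startTime t).trans (Nat.le_add_left _ i)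
      have h2 : √((label t : ℝ) + 1) ≤ d + i + 1 := by
        have h3 := sqrt_le_depth (i + n)
        have h4 : √((label t : ℝ) + 1) ≤ √(((i + n : ℕ) : ℝ) + 1) :=
          Real.sqrt_le_sqrt (by push_cast; linarith)
        linarith [Nat.cast_nonneg (α := ℝ) i]
      have h3 : √((label t : ℝ) + 1) ≤ i + n + 1 := by
        refine Real.sqrt_le_iff.2 ⟨by positivity, ?_⟩
        nlinarith [Nat.cast_nonneg (α := ℝ) (label t)]
      have h4 := one_div_le_one_div_of_le hs h2
      have h5 := one_div_le_one_div_of_le hs h3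
      rw [hqt]
      calc 2 * (1 / ((d : ℝ) + i + 1) + 1 / ((i : ℝ) + n + 1)) * (r (label t) : ℝ) ^ 2
          ≤ 2 * (1 / √((label t : ℝ) + 1) + 1 / √((label t : ℝ) + 1)) *
            ((r (label t) : ℝ) ^ 2 + 1) :=
            mul_le_mul (by linarith) (by linarith) (by positivity) (by positivity)
        _ = 4 * ((r (label t) : ℝ) ^ 2 + 1) / √(label t + 1) := by ring
    · have hi : (label t : ℝ) + q + 2 ≤ i := by
        have : label t + q + 2 ≤ i := by rw [← hn, ← hq] at h; omega
        exact_mod_cast this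
      have h0 : (0 : ℝ) < label t + q + 2 := by positivity
      have h4 := one_div_le_one_div_of_le h0
        (show (label t : ℝ) + q + 2 ≤ d + i + 1 by linarith [Nat.cast_nonneg (α := ℝ) d])
      have h5 := one_div_le_one_div_of_le h0
        (show (label t : ℝ) + q + 2 ≤ i + n + 1 by linarith [Nat.cast_nonneg (α := ℝ) n])
      calc 2 * (1 / ((d : ℝ) + i + 1) + 1 / ((i : ℝ) + n + 1)) * (r q : ℝ) ^ 2
          ≤ 2 * (1 / ((label t : ℝ) + q + 2) + 1 / ((label t : ℝ) + q + 2)) * (r q : ℝ) ^ 2 :=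
            mul_le_mul_of_nonneg_right (by linarith) (by positivity)
        _ = 4 * (r q : ℝ) ^ 2 / ((label t : ℝ) + q + 2) := by ring
        _ ≤ 4 / √(label t + 1) := by
            rw [div_le_div_iff₀ h0 hs]
            nlinarith [hP.sq_mul_sqrt_le (label t) q]
        _ ≤ 4 * ((r (label t) : ℝ) ^ 2 + 1) / √(label t + 1) :=
            div_le_div_of_nonneg_right (by nlinarith [sq_nonneg (r (label t) : ℝ)]) hs.le

end IsSlowFamily

theorem exists_simultaneous_approximation (hP : IsSlowFamily P r) (hQ : IsSlowFamily Q r) :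
    ∃ x : CZeroSumEllOne, x 0 0 = 0 ∧ ∀ t,
      ‖(backwardShift ^ startTime t) x - P (label t)‖ ≤
        6 * ((r (label t) : ℝ) ^ 2 + 1) / √(label t + 1) ∧
      ‖(backwardShift ^ startTime t) (liftRows x) - Q (label t)‖ ≤
        6 * ((r (label t) : ℝ) ^ 2 + 1) / √(label t + 1) := by
  refine ⟨hP.placed + buryRows hQ.placed, ?_, fun t => ?_⟩
  · change hP.placed 0 0 + buryRows hQ.placed 0 0 = 0
    rw [hP.placed_zero, buryRows_apply, if_pos (show 0 < depth 0 from Nat.succ_pos _), add_zero]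
  have hs : 0 < √((label t : ℝ) + 1) := Real.sqrt_pos.2 (by positivity)
  have h2 : 2 / √((label t : ℝ) + 1) ≤ 2 * ((r (label t) : ℝ) ^ 2 + 1) / √(label t + 1) :=
    div_le_div_of_nonneg_right (by nlinarith [sq_nonneg (r (label t) : ℝ)]) hs.le
  have h3 : 6 * ((r (label t) : ℝ) ^ 2 + 1) / √((label t : ℝ) + 1) =
      2 * ((r (label t) : ℝ) ^ 2 + 1) / √(label t + 1) +
        4 * ((r (label t) : ℝ) ^ 2 + 1) / √(label t + 1) := by ring
  constructor
  · rw [map_add, add_sub_right_comm, h3]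
    exact (norm_add_le _ _).trans
      (add_le_add ((hP.norm_pow_placed_sub_le t).trans h2) (hQ.norm_pow_bury_placed_le t))
  · rw [map_add, hP.liftRows_placed, zero_add, liftRows_buryRows, h3]
    have h4 : 0 ≤ 4 * ((r (label t) : ℝ) ^ 2 + 1) / √((label t : ℝ) + 1) := by positivity
    linarith [(hQ.norm_pow_placed_sub_le t).trans h2]

end Patches

/-- A vector `x` such that `(x, liftPerturbed x)` is frequently hypercyclic for
`backwardShift ⊕ backwardShift`. -/
theorem exists_frequently_visiting : ∃ x : CZeroSumEllOne,
    ∀ V : Set (CZeroSumEllOne × CZeroSumEllOne), IsOpen V → V.Nonempty →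
      0 < lowerDensity
        {n | ((backwardShift ^ n) x, (backwardShift ^ n) (liftPerturbed x)) ∈ V} := by
  obtain ⟨P, Q, r, hP, hQ, hdense⟩ := exists_dense_slowFamilies
  obtain ⟨x, hx0, hx⟩ := exists_simultaneous_approximation hP hQ
  refine ⟨x, fun V hV hVne => ?_⟩
  obtain ⟨z, hzV, R, hR⟩ := hdense V hV hVne
  obtain ⟨ε, hε, hball⟩ := Metric.isOpen_iff.1 hV z hzV
  have hlim : Tendsto (fun v : ℕ => 6 * ((R : ℝ) ^ 2 + 1) / √(v + 1)) atTop (𝓝 0) := by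
    refine tendsto_const_nhds.div_atTop (Real.tendsto_sqrt_atTop.comp ?_)
    exact tendsto_atTop_add_const_right _ _ tendsto_natCast_atTop_atTop
  obtain ⟨M, hM⟩ := eventually_atTop.1 (hlim.eventually_lt_const hε)
  -- A late repetition of the target `z`: its size stays below `R` while the error bound tends to
  -- zero.
  obtain ⟨v, hMv, hv, hrv⟩ := hR M
  refine lowerDensity_pos_of_label v fun t ht => hball ?_
  obtain ⟨h1, h2⟩ := hx t
  rw [ht] at h1 h2
  have h3 : 6 * ((r v : ℝ) ^ 2 + 1) / √((v : ℝ) + 1) < ε := by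
    refine lt_of_le_of_lt (div_le_div_of_nonneg_right ?_ (Real.sqrt_nonneg _)) (hM v hMv)
    have : (r v : ℝ) ≤ R := Nat.cast_le.2 hrv
    gcongr
  have h4 : liftPerturbed x = liftRows x := by
    rw [liftPerturbed_apply, hx0, zero_smul, add_zero]
  rw [← hv, Metric.mem_ball, Prod.dist_eq, max_lt_iff, dist_eq_norm, dist_eq_norm, h4]
  exact ⟨h1.trans_lt h3, h2.trans_lt h3⟩

end

/-! ### Conjugation and conclusion. -/

theorem mainTheorem9 :
    ∃ T₁ T₂ : CZeroSumEllOne →L[ℂ] CZeroSumEllOne,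
      DFrequentlyHypercyclic ![T₁, T₂] ∧ ¬ DenselyDHypercyclic ![T₁, T₂] := by
  have hK : 0 < 2 * (‖liftPerturbed‖ + 1) := by positivity
  obtain ⟨c, hc⟩ : ∃ c : ℂ, c = ((2 * (‖liftPerturbed‖ + 1))⁻¹ : ℝ) := ⟨_, rfl⟩
  have hc0 : c ≠ 0 := by
    rw [hc]
    exact Complex.ofReal_ne_zero.2 (inv_ne_zero hK.ne')
  have hsmall : ‖-(c • liftPerturbed)‖ < 1 := by
    refine (norm_neg (c • liftPerturbed)).trans_lt ?_
    refine (ContinuousLinearMap.opNorm_smul_le c liftPerturbed).trans_lt ?_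
    rw [hc, Complex.norm_real, Real.norm_of_nonneg (by positivity), inv_mul_lt_one₀ hK]
    linarith [norm_nonneg liftPerturbed]
  let S : (CZeroSumEllOne →L[ℂ] CZeroSumEllOne)ˣ := Units.oneSub (-(c • liftPerturbed)) hsmall
  have hS : ∀ x, S.val x = x + c • liftPerturbed x := fun x => by
    simp [S]
  have hSinv : ∀ x, S⁻¹.val (S.val x) = x := fun x => by
    rw [← mul_apply_eq_comp, Units.inv_mul]; rfl
  have hinvS : ∀ x, S.val (S⁻¹.val x) = x := fun x => by
    rw [← mul_apply_eq_comp, Units.mul_inv]; rfl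
  have horbit : ∀ n x,
      (directSumOperator ![backwardShift, S⁻¹.val * backwardShift * S.val] ^ n) (fun _ => x) =
        ![(backwardShift ^ n) x, S⁻¹.val ((backwardShift ^ n) x +
          c • (backwardShift ^ n) (liftPerturbed x))] := fun n x => by
    funext i
    rw [directSumOperator_pow_apply]
    fin_cases i
    · rfl
    · change ((S⁻¹.val * backwardShift * S.val) ^ n) x = _
      rw [Units.conj_pow', mul_apply_eq_comp, mul_apply_eq_comp, hS, map_add, map_smul]
      rfl
  refine ⟨backwardShift, S⁻¹.val * backwardShift * S.val, ?_, fun hdense => ?_⟩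
  · obtain ⟨x, hx⟩ := exists_frequently_visiting
    refine ⟨x, fun V hV hVne => ?_⟩
    have hΦ : Continuous fun z : CZeroSumEllOne × CZeroSumEllOne =>
        (![z.1, S⁻¹.val (z.1 + c • z.2)] : Fin 2 → CZeroSumEllOne) := by
      refine continuous_pi fun i => ?_
      fin_cases i
      · exact continuous_fst
      · exact S⁻¹.val.continuous.comp (continuous_fst.add (continuous_snd.const_smul c))
    have h := hx _ (hV.preimage hΦ) ?_
    · have hset : visitSet (directSumOperator ![backwardShift, S⁻¹.val * backwardShift * S.val])
          (fun _ => x) V = {n | ((backwardShift ^ n) x, (backwardShift ^ n) (liftPerturbed x)) ∈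
            (fun z : CZeroSumEllOne × CZeroSumEllOne =>
              (![z.1, S⁻¹.val (z.1 + c • z.2)] : Fin 2 → CZeroSumEllOne)) ⁻¹' V} := by
        ext n
        simp only [visitSet, Set.mem_ofPred_eq, horbit, Set.mem_preimage]
      rw [hset]
      exact h
    · obtain ⟨v, hv⟩ := hVne
      -- Inverse of `(a, b) ↦ (a, S⁻¹ (a + c b))`; this is where `c ≠ 0` is needed.
      refine ⟨(v 0, c⁻¹ • (S.val (v 1) - v 0)), ?_⟩
      have : (![v 0, S⁻¹.val (v 0 + c • (c⁻¹ • (S.val (v 1) - v 0)))] : Fin 2 → _) = v := by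
        funext i
        fin_cases i
        · rfl
        · change S⁻¹.val (v 0 + c • (c⁻¹ • (S.val (v 1) - v 0))) = v 1
          rw [smul_inv_smul₀ hc0, add_sub_cancel, hSinv]
      exact (congrArg (· ∈ V) this).mpr hv
  · have hopen : IsOpen {x : CZeroSumEllOne | 1 < ‖x 0 0‖} :=
      isOpen_lt continuous_const (CZeroSumEllOne.coordCLM 0 0).continuous.norm
    obtain ⟨x, hx1, hx⟩ := hdense.inter_open_nonempty _ hopen ⟨(2 : ℂ) • unitVector 0 0, by
      change 1 < ‖(2 : ℂ) * unitVector 0 0 0 0‖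
      rw [unitVector_apply]; simp⟩
    -- In the coordinates `(Bⁿ x, Bⁿ L' x)` this is a product of open unit balls.
    have hW : IsOpen {v : Fin 2 → CZeroSumEllOne |
        ‖v 0‖ < 1 ∧ ‖c⁻¹ • (S.val (v 1) - v 0)‖ < 1} := by
      refine (isOpen_lt (continuous_apply 0).norm continuous_const).inter
        (isOpen_lt (Continuous.norm ?_) continuous_const)
      have h0 : Continuous fun v : Fin 2 → CZeroSumEllOne => v 0 := continuous_apply 0
      have h1 : Continuous fun v : Fin 2 → CZeroSumEllOne => S.val (v 1) :=
        S.val.continuous.comp (continuous_apply 1)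
      exact (h1.sub h0).const_smul c⁻¹
    obtain ⟨_, hv, n, rfl⟩ := Dense.inter_open_nonempty hx _ hW ⟨0, by simp⟩
    simp only [Set.mem_ofPred_eq, horbit, Matrix.cons_val_zero, Matrix.cons_val_one, hinvS,
      add_sub_cancel_left, inv_smul_smul₀ hc0] at hv
    exact absurd hv.2 (not_lt.2 (one_le_norm_pow_liftPerturbed n x hx1.le hv.1.le))
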